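/- Let $\tau$ be a relational vocabulary. For every sentence $\phi$ of inclusion logic $\mathrm{FO}(\subseteq)$ over $\tau$ there is a sentence $\psi$ of probabilistic inclusion logic $\mathrm{FO}(\approx)$ over $\tau$ such that for every finite $\tau$-structure $\mathfrak A$ with at least two elements, $$\mathfrak A\models\phi \quad\Longleftrightarrow\quad \mathfrak A\models\psi .$$ Here $\mathrm{FO}(\subseteq)$ and $\mathrm{FO}(\approx)$ are the extensions of first-order logic (in negation normal form, over $\tau$) by inclusion atoms $\vec x\subseteq\vec y$ and by marginal identity atoms $\vec x\approx\vec y$, respectively, where $\vec x,\vec y$ are tuples of variables of the same length. A sentence is a formula without free variables. The sentence $\psi$ is evaluated in probabilistic team semantics. A probabilistic team $\mathbb X$ with a finite variable domain $D$ is a probability distribution on assignments $D\to A$; the empty probabilistic team is also allowed. Write $|\mathbb X_{\vec x=\vec a}|$ for the total weight of the assignments that map $\vec x$ to $\vec a$, write $\mathbb X{\upharpoonright}V$ for the marginal of $\mathbb X$ on $V\subseteq D$, and let $n=|A|$. A literal holds in $\mathbb X$ if it holds for all assignments in the support of $\mathbb X$; $\vec x\approx\vec y$ holds if $|\mathbb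 X_{\vec x=\vec a}|=|\mathbb X_{\vec y=\vec a}|$ for all $\vec a$; $\theta_1\land\theta_2$ holds if both conjuncts do; $\theta_1\lor\theta_2$ holds if $\mathbb X=\alpha\mathbb Y+(1-\alpha)\mathbb Z$ for some $\alpha\in[0,1]$ and probabilistic teams $\mathbb Y,\mathbb Z$ that satisfy $\theta_1$ and $\theta_2$, respectively; $\exists x\,\theta$ holds if $\theta$ holds in some probabilistic team on $D\cup\{x\}$ that has the same marginal on $D\setminus\{x\}$ as $\mathbb X$; $\forall x\,\theta$ holds if $\theta$ holds in the team $\mathbb X[A/x]$ on $D\cup\{x\}$ given by $s\mapsto (\mathbb X{\upharpoonright}(D\setminus\{x\}))(s{\upharpoonright}(D\setminus\{x\}))/n$. A sentence holds in $\mathfrak A$ if it holds in the distribution that gives weight $1$ to the empty assignment. The sentence $\phi$ may be evaluated in either of the following two ways, and the equivalence holds, with the same $\psi$, for both: (a) in probabilistic team semantics as above, where $\vec x\subseteq\vec y$ holds in $\mathbb X$ if for every $s$ in the support of $\mathbb X$ there is $s'$ in the support with $s(\vec x)=s'(\vec y)$; (b) in ordinary (lax) team semantics. In (b) a team is a set $X$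 of assignments; literals hold if they hold for all $s\in X$; $\vec x\subseteq\vec y$ holds if for every $s\in X$ there is $s'\in X$ with $s(\vec x)=s'(\vec y)$; conjunction is as usual; $\theta_1\lor\theta_2$ holds if $X=Y\cup Z$ for some teams $Y,Z$ that satisfy $\theta_1$ and $\theta_2$, respectively; $\exists x\,\theta$ holds if there is a function $F$ that assigns to each $s\in X$ a nonempty subset of $A$ such that $\theta$ holds in $\{s(a/x): s\in X,\ a\in F(s)\}$; $\forall x\,\theta$ holds if $\theta$ holds in $\{s(a/x): s\in X,\ a\in A\}$; and a sentence holds in $\mathfrak A$ if it holds in the team that consists of the empty assignment. -/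

import Mathlib

open FirstOrder

namespace TeamLogic

/-- The kinds of dependency atoms: inclusion atoms `x ⊆ y` and marginal identity atoms `x ≈ y`. -/
inductive DepKind where
  | inclusion
  | marginalIdentity

/-- `Formula L C D`: the formulae of `FO(C)` over the relational vocabulary `L`, in negation normal
form, whose free variables all belong to the finite set `D`. Variables are natural numbers and may
be quantified repeatedly. The first-order terms are the variables. -/
inductive Formula (L : Language) (C : Set DepKind) : Finset ℕ → Type _ where
  | eq {D : Finset ℕ} (x y : D) : Formula L C D
  | neq {D : Finset ℕ} (x y : D) : Formula L C D
  | rel {D : Finset ℕ} {n : ℕ} (R : L.Relations n) (x : Fin n → D) : Formula L C D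
  | nrel {D : Finset ℕ} {n : ℕ} (R : L.Relations n) (x : Fin n → D) : Formula L C D
  | dep {D : Finset ℕ} (d : DepKind) (hd : d ∈ C) {n : ℕ} (x y : Fin n → D) : Formula L C D
  | and {D : Finset ℕ} (φ ψ : Formula L C D) : Formula L C D
  | or {D : Finset ℕ} (φ ψ : Formula L C D) : Formula L C D
  | ex {D : Finset ℕ} (x : ℕ) (φ : Formula L C (insert x D)) : Formula L C D
  | all {D : Finset ℕ} (x : ℕ) (φ : Formula L C (insert x D)) : Formula L C D

/-- Sentences of `FO(C)`: formulae without free variables. -/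
abbrev Sentence (L : Language) (C : Set DepKind) := Formula L C ∅

/-- Sentences of inclusion logic `FO(⊆)`. -/
abbrev InclusionSentence (L : Language) := Sentence L {DepKind.inclusion}

/-- Sentences of probabilistic inclusion logic `FO(≈)`. -/
abbrev ProbInclusionSentence (L : Language) := Sentence L {DepKind.marginalIdentity}

/-- Assignments with variable domain `D` and value domain `A`. -/
abbrev Assignment (D : Finset ℕ) (A : Type*) := D → A

/-- The assignment `s(a/x)`, with variable domain `D ∪ {x}`. -/
def Assignment.update {D : Finset ℕ} {A : Type*} (s : Assignment D A) (x : ℕ) (a : A) :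
    Assignment (insert x D) A :=
  fun y => if h : (y : ℕ) = x then a else s ⟨y, Finset.mem_of_mem_insert_of_ne y.2 h⟩

/-! ### Relational team semantics -/

/-- Satisfaction of an inclusion atom `x ⊆ y` in a team. -/
def InclusionHolds {D : Finset ℕ} {A : Type*} (X : Set (Assignment D A)) {n : ℕ}
    (x y : Fin n → D) : Prop :=
  ∀ s ∈ X, ∃ s' ∈ X, (fun i => s (x i)) = (fun i => s' (y i))

/-- (Lax) team semantics of inclusion logic. -/
def TeamSat {L : Language} {A : Type*} [L.Structure A] : {D : Finset ℕ} →
    Set (Assignment D A) → Formula L {DepKind.inclusion} D → Prop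
  | _, X, .eq x y => ∀ s ∈ X, s x = s y
  | _, X, .neq x y => ∀ s ∈ X, s x ≠ s y
  | _, X, .rel R x => ∀ s ∈ X, Language.Structure.RelMap R (fun i => s (x i))
  | _, X, .nrel R x => ∀ s ∈ X, ¬ Language.Structure.RelMap R (fun i => s (x i))
  | _, X, .dep _ _ x y => InclusionHolds X x y
  | _, X, .and φ ψ => TeamSat X φ ∧ TeamSat X ψ
  | _, X, .or φ ψ => ∃ Y Z, Y ∪ Z = X ∧ TeamSat Y φ ∧ TeamSat Z ψ
  | D, X, .ex x φ => ∃ F : Assignment D A → Set A, (∀ s ∈ X, (F s).Nonempty) ∧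
      TeamSat {t | ∃ s ∈ X, ∃ a ∈ F s, t = s.update x a} φ
  | _, X, .all x φ => TeamSat {t | ∃ s ∈ X, ∃ a : A, t = s.update x a} φ

/-- `A ⊨ φ` in team semantics: `φ` is satisfied by the team of the empty assignment alone. -/
def TeamModels {L : Language} (A : Type*) [L.Structure A] (φ : InclusionSentence L) : Prop :=
  TeamSat (A := A) Set.univ φ

/-! ### Probabilistic team semantics -/

/-- Weight functions on the assignments with variable domain `D` and value domain `A`. A function
that is given on a subset of these assignments is extended by `0`. -/
abbrev Weight (D : Finset ℕ) (A : Type*) := Assignment D A → ℝ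

/-- Probabilistic teams: probability distributions on assignments, and the empty probabilistic team
(which is the zero function here). -/
def IsProbTeam {D : Finset ℕ} {A : Type*} [Fintype A] (X : Weight D A) : Prop :=
  (∀ s, 0 ≤ X s) ∧ (∑ s, X s = 1 ∨ X = 0)

/-- The support of a probabilistic team. -/
def supp {D : Finset ℕ} {A : Type*} (X : Weight D A) : Set (Assignment D A) := {s | 0 < X s}

open Classical in
/-- The projection of `X` on `V ⊆ D`. -/
noncomputable def proj {D V : Finset ℕ} {A : Type*} [Fintype A] (h : V ⊆ D) (X : Weight D A) :
    Weight V A :=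
  fun s => ∑ t with Finset.restrict₂ (π := fun _ => A) h t = s, X t

theorem erase_subset_insert (D : Finset ℕ) (x : ℕ) : D.erase x ⊆ insert x D :=
  (D.erase_subset x).trans (D.subset_insert x)

/-- The probabilistic team `X[A/x]`. -/
noncomputable def duplicate {D : Finset ℕ} {A : Type*} [Fintype A] (X : Weight D A) (x : ℕ) :
    Weight (insert x D) A :=
  fun s => proj (D.erase_subset x) X
    (Finset.restrict₂ (π := fun _ => A) (erase_subset_insert D x) s) / (Fintype.card A : ℝ)

/-- The set `S[x, A](X)` of all probabilistic teams with variable domain `D ∪ {x}` that have the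
same projection on `D \ {x}` as `X`. -/
def supplement {D : Finset ℕ} {A : Type*} [Fintype A] (X : Weight D A) (x : ℕ) :
    Set (Weight (insert x D) A) :=
  {Y | IsProbTeam Y ∧ proj (erase_subset_insert D x) Y = proj (D.erase_subset x) X}

open Classical in
/-- `|X_{x = a}|`: the total weight of the assignments that map the tuple `x` to `a`. -/
noncomputable def weightAt {D : Finset ℕ} {A : Type*} [Fintype A] (X : Weight D A) {n : ℕ}
    (x : Fin n → D) (a : Fin n → A) : ℝ :=
  ∑ s with (fun i => s (x i)) = a, X s

/-- Satisfaction of dependency atoms in a probabilistic team. A relational dependency is evaluated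
on the support. -/
def DepHolds {D : Finset ℕ} {A : Type*} [Fintype A] (X : Weight D A) {n : ℕ} :
    DepKind → (Fin n → D) → (Fin n → D) → Prop
  | .inclusion, x, y => InclusionHolds (supp X) x y
  | .marginalIdentity, x, y => ∀ a : Fin n → A, weightAt X x a = weightAt X y a

/-- Probabilistic team semantics of `FO(C)`. -/
def ProbSat {L : Language} {C : Set DepKind} {A : Type*} [Fintype A] [L.Structure A] :
    {D : Finset ℕ} → Weight D A → Formula L C D → Prop
  | _, X, .eq x y => ∀ s ∈ supp X, s x = s y
  | _, X, .neq x y => ∀ s ∈ supp X, s x ≠ s y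
  | _, X, .rel R x => ∀ s ∈ supp X, Language.Structure.RelMap R (fun i => s (x i))
  | _, X, .nrel R x => ∀ s ∈ supp X, ¬ Language.Structure.RelMap R (fun i => s (x i))
  | _, X, .dep d _ x y => DepHolds X d x y
  | _, X, .and φ ψ => ProbSat X φ ∧ ProbSat X ψ
  | _, X, .or φ ψ => ∃ Y Z, IsProbTeam Y ∧ IsProbTeam Z ∧
      (∃ α ∈ Set.Icc (0 : ℝ) 1, α • Y + (1 - α) • Z = X) ∧ ProbSat Y φ ∧ ProbSat Z ψ
  | _, X, .ex x φ => ∃ Y ∈ supplement X x, ProbSat Y φ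
  | _, X, .all x φ => ProbSat (duplicate X x) φ

/-- `A ⊨ φ` in probabilistic team semantics: `φ` is satisfied by the distribution that maps the
empty assignment to `1`. -/
def ProbModels {L : Language} {C : Set DepKind} (A : Type*) [Fintype A] [L.Structure A]
    (φ : Sentence L C) : Prop :=
  ProbSat (A := A) (fun _ => 1) φ

end TeamLogic

namespace TeamLogic

open FirstOrder Finset

variable {A : Type*} {D : Finset ℕ}

/-! ### Updates -/

/-! An inclusion atom constrains only supports, while a marginal identity compares weights. Let n =
|A|. If every weight in the support of X is at least 1 / n ^ k, then x ⊆ y can be expressed by ≈: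
universally quantify k + 1 fresh variables, which agree with probability 1 / n ^ k independently of
X, and ask for a tuple u ≈ y that equals x whenever they agree. If the inclusion holds, each value
of x needs at most weight 1 / n ^ k for u, and y gives that value at least this weight; the
remaining weight of y is distributed over the complement of the event (`exists_extension`,
`boundedInclusion_of_inclusionHolds`). Conversely, every assignment in the support meets the event
with positive weight, so its value of x is a value of u and hence of y. This needs no bound on the
weights (`inclusionHolds_of_boundedInclusion`).

The exponent k is chosen syntactically. Starting from weight 1, witnessing teams can be built so
that a disjunction at most halves the weights and a quantifier divides them by at most n. As n ≥ 2,
each costs at most one factor n, and k need only count the disjunctions and quantifiers above an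
atom. The translation therefore does not depend on A.

The equivalences follow from a cycle: team satisfaction of φ gives the translation
(`translate_of_teamSat`), the translation gives probabilistic satisfaction of φ
(`probSat_of_translate`), and passing to supports gives team satisfaction again
(`teamSat_of_probSat`). -/

theorem restrict_injective_of_subset {U V : Finset ℕ} (h : U ⊆ V) (h' : V ⊆ U) :
    Function.Injective (Finset.restrict₂ (π := fun _ => A) h) := fun s t hst => by
  ext v
  exact congrFun hst ⟨v, h' v.2⟩

theorem restrict_update (s : Assignment D A) (x : ℕ) (a : A) :
    Finset.restrict₂ (π := fun _ => A) (erase_subset_insert D x) (s.update x a) =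
      Finset.restrict₂ (π := fun _ => A) (D.erase_subset x) s := by
  ext v
  simp [Assignment.update, Finset.ne_of_mem_erase v.2]

theorem update_self (s : Assignment D A) (x : ℕ) (a : A) :
    s.update x a ⟨x, Finset.mem_insert_self x D⟩ = a := by
  simp [Assignment.update]

theorem eq_update_of_restrict {s : Assignment D A} {x : ℕ} {t : Assignment (insert x D) A}
    (h : Finset.restrict₂ (π := fun _ => A) (erase_subset_insert D x) t =
      Finset.restrict₂ (π := fun _ => A) (D.erase_subset x) s) :
    t = s.update x (t ⟨x, Finset.mem_insert_self x D⟩) := by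
  ext ⟨v, hv⟩
  by_cases hvx : v = x
  · subst hvx
    simp [Assignment.update]
  · have hD : v ∈ D.erase x :=
      Finset.mem_erase.2 ⟨hvx, Finset.mem_of_mem_insert_of_ne hv hvx⟩
    have := congrFun h ⟨v, hD⟩
    simp only [Finset.restrict₂] at this
    simp [Assignment.update, hvx, this]

variable [Fintype A]

/-! ### Push-forwards of weight functions -/

section Push

variable {ι κ μ : Type*} [Fintype ι]

open Classical in
/-- The push-forward of a weight function along a map. -/
noncomputable def push (f : ι → κ) (w : ι → ℝ) : κ → ℝ :=
  fun k => ∑ i with f i = k, w i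

theorem push_apply [DecidableEq κ] (f : ι → κ) (w : ι → ℝ) (k : κ) :
    push f w k = ∑ i, if f i = k then w i else 0 := by
  unfold push
  rw [Finset.sum_filter]
  exact Finset.sum_congr rfl fun i _ => by congr

theorem sum_push [Fintype κ] (f : ι → κ) (w : ι → ℝ) : ∑ k, push f w k = ∑ i, w i := by
  classical
  simp only [push_apply]
  rw [Finset.sum_comm]
  simp

theorem push_push [Fintype κ] (g : κ → μ) (f : ι → κ) (w : ι → ℝ) :
    push g (push f w) = push (g ∘ f) w := by
  classical
  ext m
  simp only [push_apply, Function.comp]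
  simp_rw [← Finset.sum_filter (fun k => g k = m)]
  rw [Finset.sum_comm]
  refine Finset.sum_congr rfl fun i _ => ?_
  simp [Finset.sum_ite_eq]

theorem push_nonneg (f : ι → κ) {w : ι → ℝ} (hw : ∀ i, 0 ≤ w i) (k : κ) : 0 ≤ push f w k :=
  Finset.sum_nonneg fun i _ => hw i

theorem le_push (f : ι → κ) {w : ι → ℝ} (hw : ∀ i, 0 ≤ w i) (i : ι) : w i ≤ push f w (f i) := by
  classical
  exact Finset.single_le_sum (f := w) (fun i _ => hw i) (by simp)

theorem push_pos_iff (f : ι → κ) {w : ι → ℝ} (hw : ∀ i, 0 ≤ w i) (k : κ) :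
    0 < push f w k ↔ ∃ i, f i = k ∧ 0 < w i := by
  classical
  unfold push
  rw [Finset.sum_pos_iff_of_nonneg fun i _ => hw i]
  simp

theorem push_fst {β : Type*} [Fintype β] (f : ι → κ) (w : ι × β → ℝ) :
    push (fun p : ι × β => f p.1) w = push f fun i => ∑ b, w (i, b) := by
  classical
  ext k
  simp only [push_apply, Fintype.sum_prod_type]
  refine Finset.sum_congr rfl fun i _ => ?_
  split_ifs <;> simp

theorem push_injective_apply {f : ι → κ} (hf : Function.Injective f) (w : ι → ℝ) (i : ι) :
    push f w (f i) = w i := by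
  classical
  simp [push_apply, hf.eq_iff]

end Push

/-! ### Marginals as push-forwards -/

theorem proj_eq_push {V : Finset ℕ} (h : V ⊆ D) (X : Weight D A) :
    proj h X = push (Finset.restrict₂ (π := fun _ => A) h) X := by
  classical
  ext s
  rw [push_apply, proj, Finset.sum_filter]

theorem weightAt_eq_push {n : ℕ} (x : Fin n → D) (X : Weight D A) :
    weightAt X x = push (fun s i => s (x i)) X := by
  classical
  ext a
  rw [push_apply, weightAt, Finset.sum_filter]

theorem proj_proj {U V : Finset ℕ} (hUV : U ⊆ V) (hVD : V ⊆ D) (X : Weight D A) :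
    proj hUV (proj hVD X) = proj (hUV.trans hVD) X := by
  rw [proj_eq_push, proj_eq_push, proj_eq_push, push_push]
  rfl

theorem weightAt_proj {V : Finset ℕ} (h : V ⊆ D) (X : Weight D A) {n : ℕ} (x : Fin n → V) :
    weightAt (proj h X) x = weightAt X fun i => ⟨x i, h (x i).2⟩ := by
  rw [proj_eq_push, weightAt_eq_push, weightAt_eq_push, push_push]
  rfl

theorem isProbTeam_push {ι : Type*} [Fintype ι] (f : ι → Assignment D A) {w : ι → ℝ}
    (hw : ∀ i, 0 ≤ w i) (hs : ∑ i, w i = 1 ∨ w = 0) : IsProbTeam (push f w) := by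
  refine ⟨push_nonneg f hw, ?_⟩
  rw [sum_push]
  refine hs.imp_right fun h => ?_
  subst h
  ext
  simp [push]

theorem IsProbTeam.proj {V : Finset ℕ} (h : V ⊆ D) {X : Weight D A} (hX : IsProbTeam X) :
    IsProbTeam (TeamLogic.proj h X) := by
  rw [proj_eq_push]
  exact isProbTeam_push _ hX.1 hX.2

theorem IsProbTeam.sum_le_one {X : Weight D A} (hX : IsProbTeam X) : ∑ s, X s ≤ 1 := by
  rcases hX.2 with h | rfl
  · exact h.le
  · simp

theorem mem_supp_proj {V : Finset ℕ} (h : V ⊆ D) {X : Weight D A} (hX : IsProbTeam X)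
    (s : Assignment V A) :
    s ∈ supp (TeamLogic.proj h X) ↔
      ∃ t ∈ supp X, Finset.restrict₂ (π := fun _ => A) h t = s := by
  rw [supp, Set.mem_ofPred_eq, proj_eq_push, push_pos_iff _ hX.1]
  exact exists_congr fun _ => and_comm

/-! ### Supplementation and duplication -/

/-- For a given target t, an assignment s contributes through at most one value a, namely the value
of t at x, so each s is counted once. -/
theorem duplicate_eq_push (X : Weight D A) (x : ℕ) :
    duplicate X x =
      push (fun p : Assignment D A × A => p.1.update x p.2) fun p => X p.1 / Fintype.card A := by
  classical
  ext t
  simp only [duplicate, proj_eq_push, push_apply, Fintype.sum_prod_type, Finset.sum_div]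
  refine Finset.sum_congr rfl fun s _ => ?_
  by_cases h : Finset.restrict₂ (π := fun _ => A) (erase_subset_insert D x) t =
      Finset.restrict₂ (π := fun _ => A) (D.erase_subset x) s
  · rw [if_pos h.symm, Finset.sum_eq_single (t ⟨x, Finset.mem_insert_self x D⟩)]
    · rw [if_pos (eq_update_of_restrict h).symm]
    · rintro a - ha
      refine if_neg ?_
      rintro rfl
      exact ha (update_self s x a).symm
    · simp
  · rw [if_neg (Ne.symm h), zero_div]
    refine (Finset.sum_eq_zero fun a _ => if_neg ?_).symm
    rintro rfl
    exact h (restrict_update s x a)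

theorem sum_div_card [Nonempty A] (c : ℝ) : ∑ _a : A, c / Fintype.card A = c := by
  have : (Fintype.card A : ℝ) ≠ 0 := by simp
  rw [Finset.sum_const, Finset.card_univ, nsmul_eq_mul]
  field_simp

/-- Weights obtained by distributing the weight of each assignment over values of `x`. -/
theorem push_update_mem_supplement {X : Weight D A} (hX : IsProbTeam X) (x : ℕ)
    {w : Assignment D A × A → ℝ} (hw : ∀ p, 0 ≤ w p) (hs : ∀ s, ∑ a, w (s, a) = X s) :
    push (fun p : Assignment D A × A => p.1.update x p.2) w ∈ supplement X x := by
  refine ⟨isProbTeam_push _ hw ?_, ?_⟩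
  · rw [Fintype.sum_prod_type]
    simp only [hs]
    refine hX.2.imp_right fun h => ?_
    ext ⟨s, a⟩
    have := hs s
    rw [h, Pi.zero_apply, Finset.sum_eq_zero_iff_of_nonneg fun _ _ => hw _] at this
    exact this a (Finset.mem_univ a)
  · simp only [proj_eq_push, push_push]
    simp only [Function.comp_def, restrict_update]
    rw [push_fst (Finset.restrict₂ (π := fun _ => A) (D.erase_subset x)) w]
    simp only [hs]

theorem duplicate_mem_supplement [Nonempty A] {X : Weight D A} (hX : IsProbTeam X) (x : ℕ) :
    duplicate X x ∈ supplement X x := by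
  rw [duplicate_eq_push]
  exact push_update_mem_supplement hX x (fun p => div_nonneg (hX.1 _) (Nat.cast_nonneg _))
    fun s => sum_div_card (X s)

/-! ### Supports -/

theorem supp_duplicate [Nonempty A] {X : Weight D A} (hX : IsProbTeam X) (x : ℕ) :
    supp (duplicate X x) = {t | ∃ s ∈ supp X, ∃ a : A, t = s.update x a} := by
  ext t
  rw [duplicate_eq_push, supp, Set.mem_ofPred_eq,
    push_pos_iff _ fun p => div_nonneg (hX.1 _) (Nat.cast_nonneg _)]
  have : (0 : ℝ) < Fintype.card A := by simp [Fintype.card_pos]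
  constructor
  · rintro ⟨⟨s, a⟩, rfl, h⟩
    exact ⟨s, (div_pos_iff_of_pos_right this).1 h, a, rfl⟩
  · rintro ⟨s, h, a, rfl⟩
    exact ⟨⟨s, a⟩, rfl, (div_pos_iff_of_pos_right this).2 h⟩

/-- The support of a supplement is a lax supplement of the support: equality of the marginals away
from x forces every s to have a successor and every t to have a predecessor. -/
theorem supp_of_mem_supplement {X : Weight D A} (hX : IsProbTeam X) {x : ℕ}
    {Y : Weight (insert x D) A} (hY : Y ∈ supplement X x) :
    (∀ s ∈ supp X, {a | s.update x a ∈ supp Y}.Nonempty) ∧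
      {t | ∃ s ∈ supp X, ∃ a ∈ {a | s.update x a ∈ supp Y}, t = s.update x a} = supp Y := by
  refine ⟨fun s hs => ?_, Set.ext fun t => ⟨?_, fun ht => ?_⟩⟩
  · have h := (mem_supp_proj (D.erase_subset x) hX _).2 ⟨s, hs, rfl⟩
    rw [← hY.2, mem_supp_proj _ hY.1] at h
    obtain ⟨t, ht, h⟩ := h
    refine ⟨t ⟨x, Finset.mem_insert_self x D⟩, ?_⟩
    rw [Set.mem_ofPred_eq, ← eq_update_of_restrict h]
    exact ht
  · rintro ⟨s, -, a, ha, rfl⟩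
    exact ha
  · have h := (mem_supp_proj (erase_subset_insert D x) hY.1 _).2 ⟨t, ht, rfl⟩
    rw [hY.2, mem_supp_proj _ hX] at h
    obtain ⟨s, hs, h⟩ := h
    have e := eq_update_of_restrict h.symm
    exact ⟨s, hs, _, by rw [Set.mem_ofPred_eq, ← e]; exact ht, e⟩

open Classical in
-- The weight of s is shared equally among the at most |A| values in F s. If updates of different
-- assignments coincide, their weights add up, which only helps the lower bound.
theorem exists_mem_supplement {X : Weight D A} (hX : IsProbTeam X) {c : ℝ}
    (hc : ∀ s ∈ supp X, c ≤ X s) (x : ℕ) {F : Assignment D A → Set A}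
    (hF : ∀ s ∈ supp X, (F s).Nonempty) :
    ∃ Y ∈ supplement X x, supp Y = {t | ∃ s ∈ supp X, ∃ a ∈ F s, t = s.update x a} ∧
      ∀ t ∈ supp Y, c / Fintype.card A ≤ Y t := by
  let w : Assignment D A × A → ℝ := fun p => if p.2 ∈ F p.1 then X p.1 / #{a | a ∈ F p.1} else 0
  have hcard : ∀ s ∈ supp X, 0 < (#{a | a ∈ F s} : ℝ) := fun s hs => by
    obtain ⟨a, ha⟩ := hF s hs
    exact Nat.cast_pos.2 (Finset.card_pos.2 ⟨a, by simpa using ha⟩)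
  have hw : ∀ p, 0 ≤ w p := fun p => by
    simp only [w]
    split_ifs
    · exact div_nonneg (hX.1 _) (Nat.cast_nonneg _)
    · exact le_rfl
  have hpos : ∀ p : Assignment D A × A, 0 < w p ↔ p.1 ∈ supp X ∧ p.2 ∈ F p.1 := fun p => by
    simp only [w]
    split_ifs with h
    · refine ⟨fun h' => ⟨lt_of_le_of_ne (hX.1 _) fun h0 => ?_, h⟩, fun h' => ?_⟩
      · rw [← h0, zero_div] at h'
        exact lt_irrefl _ h'
      · exact div_pos h'.1 (hcard _ h'.1)
    · simp [h]
  have hsupp : ∀ t, 0 < push (fun p : Assignment D A × A => p.1.update x p.2) w t ↔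
      ∃ s ∈ supp X, ∃ a ∈ F s, t = s.update x a := fun t => by
    rw [push_pos_iff _ hw]
    constructor
    · rintro ⟨⟨s, a⟩, rfl, h⟩
      exact ⟨s, ((hpos _).1 h).1, a, ((hpos _).1 h).2, rfl⟩
    · rintro ⟨s, hs, a, ha, rfl⟩
      exact ⟨⟨s, a⟩, rfl, (hpos _).2 ⟨hs, ha⟩⟩
  refine ⟨_, push_update_mem_supplement hX x hw fun s => ?_, Set.ext hsupp, fun t ht => ?_⟩
  · simp only [w]
    rw [← Finset.sum_filter, Finset.sum_const, nsmul_eq_mul]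
    rcases (hX.1 s).eq_or_lt with h | h
    · simp [← h]
    · have := hcard s h
      field_simp
  · obtain ⟨s, hs, a, ha, rfl⟩ := (hsupp t).1 ht
    refine le_trans ?_ (le_push (fun p : Assignment D A × A => p.1.update x p.2) hw (s, a))
    simp only [w, if_pos ha]
    have h0 : 0 ≤ X s := hX.1 s
    have h1 := hcard s hs
    have h2 : (#{a | a ∈ F s} : ℝ) ≤ Fintype.card A := Nat.cast_le.2 (Finset.card_le_univ _)
    calc c / Fintype.card A ≤ X s / Fintype.card A := by
          gcongr
          exact hc s hs
      _ ≤ _ := by gcongr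

theorem le_duplicate [Nonempty A] {X : Weight D A} (hX : IsProbTeam X) {c : ℝ}
    (hc : ∀ s ∈ supp X, c ≤ X s) (x : ℕ) :
    ∀ t ∈ supp (duplicate X x), c / Fintype.card A ≤ duplicate X x t := by
  intro t ht
  rw [supp_duplicate hX] at ht
  obtain ⟨s, hs, a, rfl⟩ := ht
  rw [duplicate_eq_push]
  refine le_trans ?_ (le_push (fun p : Assignment D A × A => p.1.update x p.2)
    (fun p => div_nonneg (hX.1 _) (Nat.cast_nonneg _)) (s, a))
  have := hc s hs
  gcongr

/-! ### Splitting teams -/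

/-- Scaling a subprobability up to total weight 1 can only increase weights. Total weight 0 yields
the empty team. -/
theorem exists_normalization {y : Weight D A} (hy : ∀ s, 0 ≤ y s) (h1 : ∑ s, y s ≤ 1) :
    ∃ Y, IsProbTeam Y ∧ supp Y = supp y ∧ (∀ s, y s ≤ Y s) ∧ (∑ s, y s) • Y = y := by
  rcases (Finset.sum_nonneg fun s _ => hy s : 0 ≤ ∑ s, y s).eq_or_lt with h | h
  · have hy0 : y = 0 := by
      ext s
      exact (Finset.sum_eq_zero_iff_of_nonneg fun s _ => hy s).1 h.symm s (Finset.mem_univ s)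
    exact ⟨y, ⟨hy, .inr hy0⟩, rfl, fun _ => le_rfl, by rw [hy0, smul_zero]⟩
  · refine ⟨(∑ s, y s)⁻¹ • y, ⟨fun s => mul_nonneg (inv_nonneg.2 h.le) (hy s), .inl ?_⟩, ?_,
      fun s => ?_, smul_inv_smul₀ h.ne' y⟩
    · simp only [Pi.smul_apply, smul_eq_mul]
      rw [← Finset.mul_sum, inv_mul_cancel₀ h.ne']
    · ext s
      simp only [supp, Set.mem_ofPred_eq, Pi.smul_apply, smul_eq_mul]
      exact mul_pos_iff_of_pos_left (inv_pos.2 h)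
    · exact le_mul_of_one_le_left (hy s) ((one_le_inv₀ h).2 h1)

open Classical in
-- Each assignment in the overlap of S and T gives half of its weight to each side. The mixing
-- coefficient is the weight received by S.
theorem exists_split {X : Weight D A} (hX : IsProbTeam X) {c : ℝ} (hc : ∀ s ∈ supp X, c ≤ X s)
    {S T : Set (Assignment D A)} (h : S ∪ T = supp X) :
    ∃ Y Z, IsProbTeam Y ∧ IsProbTeam Z ∧
      (∃ α ∈ Set.Icc (0 : ℝ) 1, α • Y + (1 - α) • Z = X) ∧ supp Y = S ∧ supp Z = T ∧
      (∀ s ∈ S, c / 2 ≤ Y s) ∧ (∀ s ∈ T, c / 2 ≤ Z s) := by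
  let part (S T : Set (Assignment D A)) : Weight D A :=
    fun s => if s ∈ S then if s ∈ T then X s / 2 else X s else 0
  have hpart : ∀ S T : Set (Assignment D A), S ∪ T = supp X →
      (∀ s, 0 ≤ part S T s) ∧ (∑ s, part S T s ≤ 1) ∧ supp (part S T) = S ∧
        ∀ s ∈ S, c / 2 ≤ part S T s := by
    intro S T h
    have hS : ∀ s ∈ S, 0 < X s ∧ c ≤ X s := fun s hs => by
      have : s ∈ supp X := h ▸ Set.mem_union_left T hs
      exact ⟨this, hc s this⟩
    refine ⟨fun s => ?_, ?_, Set.ext fun s => ?_, fun s hs => ?_⟩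
    · have := hX.1 s
      simp only [part]
      split_ifs <;> linarith
    · refine le_trans (Finset.sum_le_sum fun s _ => ?_) hX.sum_le_one
      have := hX.1 s
      simp only [part]
      split_ifs <;> linarith
    · simp only [part, supp, Set.mem_ofPred_eq]
      split_ifs with h1 h2
      · simpa [h1] using (hS s h1).1
      · simpa [h1] using (hS s h1).1
      · simp [h1]
    · have := hS s hs
      simp only [part, if_pos hs]
      split_ifs <;> linarith
  have hadd : ∀ s, part S T s + part T S s = X s := fun s => by
    by_cases h1 : s ∈ S <;> by_cases h2 : s ∈ T <;> simp [part, h1, h2]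
    have h3 : s ∉ supp X := h ▸ by simp [h1, h2]
    exact le_antisymm (hX.1 s) (not_lt.1 h3)
  obtain ⟨hy0, hy1, hyS, hyc⟩ := hpart S T h
  obtain ⟨hz0, hz1, hzT, hzc⟩ := hpart T S (by rw [Set.union_comm, h])
  obtain ⟨Y, hY, hYs, hYle, hYe⟩ := exists_normalization hy0 hy1
  obtain ⟨Z, hZ, hZs, hZle, hZe⟩ := exists_normalization hz0 hz1
  refine ⟨Y, Z, hY, hZ, ⟨∑ s, part S T s, ⟨Finset.sum_nonneg fun s _ => hy0 s, hy1⟩, ?_⟩,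
    hYs.trans hyS, hZs.trans hzT, fun s hs => (hyc s hs).trans (hYle s),
    fun s hs => (hzc s hs).trans (hZle s)⟩
  rw [hYe]
  have hsum : ∑ s, part S T s + ∑ s, part T S s = ∑ s, X s := by
    rw [← Finset.sum_add_distrib]
    exact Finset.sum_congr rfl fun s _ => hadd s
  rcases hX.2 with h1 | rfl
  · rw [show 1 - ∑ s, part S T s = ∑ s, part T S s by linarith, hZe]
    exact funext hadd
  -- For the empty team the coefficient of Z is 1 - 0 = 1, so Z itself has to vanish.
  · have hZ0 : Z = 0 := by
      ext s
      refine le_antisymm (not_lt.1 fun hs => ?_) (hZ.1 s)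
      have : s ∈ supp (part T S) := hZs ▸ hs
      simp only [supp, Set.mem_ofPred_eq, part] at this
      split_ifs at this <;> simp at this
    ext s
    simp [hZ0, part]

theorem mem_supp_of_mix {X Y Z : Weight D A} (hY : IsProbTeam Y) (hZ : IsProbTeam Z) {α : ℝ}
    (hα : α ∈ Set.Icc (0 : ℝ) 1) (h : α • Y + (1 - α) • Z = X) (s : Assignment D A) :
    s ∈ supp X ↔ (0 < α ∧ s ∈ supp Y) ∨ (α < 1 ∧ s ∈ supp Z) := by
  have h1 := hY.1 s
  have h2 := hZ.1 s
  subst h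
  simp only [supp, Set.mem_ofPred_eq, Pi.add_apply, Pi.smul_apply, smul_eq_mul]
  have h3 : 0 ≤ α * Y s := mul_nonneg hα.1 h1
  have h4 : 0 ≤ (1 - α) * Z s := mul_nonneg (sub_nonneg.2 hα.2) h2
  constructor
  · intro h
    by_contra! hn
    have h5 : α * Y s = 0 := by
      rcases hα.1.eq_or_lt with h0 | h0
      · rw [← h0, zero_mul]
      · rw [le_antisymm (hn.1 h0) h1, mul_zero]
    have h6 : (1 - α) * Z s = 0 := by
      rcases hα.2.eq_or_lt with h0 | h0
      · rw [h0, sub_self, zero_mul]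
      · rw [le_antisymm (hn.2 h0) h2, mul_zero]
    linarith
  · rintro (⟨h0, h⟩ | ⟨h0, h⟩)
    · have := mul_pos h0 h
      linarith
    · have := mul_pos (sub_pos.2 h0) h
      linarith

end TeamLogic

namespace TeamLogic

open FirstOrder Finset

variable {L : Language} {C : Set DepKind} {A : Type*} {D : Finset ℕ}

/-! ### Blocks of quantifiers over fresh variables -/

/-- `D` together with the variables `v, …, v + m - 1`. -/
def block : Finset ℕ → ℕ → ℕ → Finset ℕ
  | D, _, 0 => D
  | D, v, m + 1 => block (insert v D) (v + 1) m

theorem mem_block {w : ℕ} {m : ℕ} : ∀ {D : Finset ℕ} {v : ℕ},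
    w ∈ block D v m ↔ w ∈ D ∨ v ≤ w ∧ w < v + m := by
  induction m with
  | zero => intro D v; simp [block]
  | succ m ih =>
    intro D v
    rw [block, ih, Finset.mem_insert]
    by_cases h : w ∈ D <;> simp only [h, or_true, true_or, or_false, false_or]
    omega

theorem subset_block (D : Finset ℕ) (v m : ℕ) : D ⊆ block D v m :=
  fun _ hw => mem_block.2 (.inl hw)

theorem lt_of_mem_block {v m : ℕ} (hD : ∀ w ∈ D, w < v) : ∀ w ∈ block D v m, w < v + m := by
  intro w hw
  rcases mem_block.1 hw with h | h
  · exact (hD w h).trans_le (Nat.le_add_right v m)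
  · exact h.2

/-- The variable `v + i` of a block. -/
def blockVar (D : Finset ℕ) (v m : ℕ) (i : Fin m) : block D v m :=
  ⟨v + i, mem_block.2 (.inr ⟨Nat.le_add_right v i, Nat.add_lt_add_left i.2 v⟩)⟩

/-- A variable of `D` as a variable of a larger domain. -/
def liftVar {D D' : Finset ℕ} (h : D ⊆ D') (x : D) : D' := ⟨x, h x.2⟩

/-- Existential quantification of the variables `v, …, v + m - 1`. -/
def exBlock : {D : Finset ℕ} → (v m : ℕ) → Formula L C (block D v m) → Formula L C D
  | _, _, 0, φ => φ
  | _, v, m + 1, φ => .ex v (exBlock (v + 1) m φ)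

/-- Universal quantification of the variables `v, …, v + m - 1`. -/
def allBlock : {D : Finset ℕ} → (v m : ℕ) → Formula L C (block D v m) → Formula L C D
  | _, _, 0, φ => φ
  | _, v, m + 1, φ => .all v (allBlock (v + 1) m φ)

/-- Extension of an assignment to a block of fresh variables. -/
def extend {v m : ℕ} (s : Assignment D A) (b : Fin m → A) : Assignment (block D v m) A :=
  fun w => if h : (w : ℕ) ∈ D then s ⟨w, h⟩ else
    b ⟨w - v, by have := (mem_block.1 w.2).resolve_left h; omega⟩

theorem restrict_extend {v m : ℕ} (s : Assignment D A) (b : Fin m → A) :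
    Finset.restrict₂ (π := fun _ => A) (subset_block D v m) (extend s b) = s := by
  ext w
  simp [extend]

theorem extend_liftVar {v m : ℕ} (s : Assignment D A) (b : Fin m → A) (x : D) :
    extend s b (liftVar (subset_block D v m) x) = s x := by
  simp [extend, liftVar]

theorem extend_blockVar {v m : ℕ} (hD : ∀ w ∈ D, w < v) (s : Assignment D A) (b : Fin m → A)
    (i : Fin m) : extend s b (blockVar D v m i) = b i := by
  have : v + i ∉ D := fun h => by have := hD _ h; omega
  simp [extend, blockVar, this]

theorem lt_succ_of_mem_insert {v : ℕ} (hD : ∀ w ∈ D, w < v) : ∀ w ∈ insert v D, w < v + 1 := by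
  intro w hw
  rcases Finset.mem_insert.1 hw with rfl | h
  · exact Nat.lt_succ_self _
  · exact (hD w h).trans (Nat.lt_succ_self _)

variable [Fintype A]

theorem proj_self (X : Weight D A) (h : D ⊆ D) : proj h X = X := by
  ext s
  rw [proj_eq_push]
  exact push_injective_apply (restrict_injective_of_subset h h) X s

/-- For fresh x the sets `D.erase x` and `D` are equal but not definitionally so; this lets
marginals on `D.erase x` be traded for teams on `D`. -/
theorem proj_erase_injective {x : ℕ} (hx : x ∉ D) :
    Function.Injective (proj (A := A) (D.erase_subset x)) := fun X Y h => by
  have hi := restrict_injective_of_subset (A := A) (D.erase_subset x)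
    (Finset.erase_eq_of_notMem hx).ge
  ext s
  rw [← push_injective_apply hi X s, ← push_injective_apply hi Y s, ← proj_eq_push,
    ← proj_eq_push, h]

theorem mem_supplement_of_notMem {x : ℕ} (hx : x ∉ D) {X : Weight D A}
    {Y : Weight (insert x D) A} :
    Y ∈ supplement X x ↔ IsProbTeam Y ∧ proj (D.subset_insert x) Y = X := by
  refine and_congr_right fun _ => ?_
  rw [← (proj_erase_injective hx).eq_iff, proj_proj]

theorem duplicate_of_notMem {x : ℕ} (hx : x ∉ D) (X : Weight D A)
    (t : Assignment (insert x D) A) :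
    duplicate X x t =
      X (Finset.restrict₂ (π := fun _ => A) (D.subset_insert x) t) / Fintype.card A := by
  have hi := restrict_injective_of_subset (A := A) (D.erase_subset x)
    (Finset.erase_eq_of_notMem hx).ge
  rw [← push_injective_apply hi X, duplicate, proj_eq_push]
  rfl

variable [L.Structure A]

/-- The teams chosen at the intermediate quantifiers can be taken to be the marginals of the final
one. -/
theorem probSat_exBlock {m : ℕ} : ∀ {D : Finset ℕ} {v : ℕ} (_ : ∀ w ∈ D, w < v) {X : Weight D A}
    (_ : IsProbTeam X) (φ : Formula L C (block D v m)),
    ProbSat X (exBlock v m φ) ↔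
      ∃ Y, IsProbTeam Y ∧ proj (subset_block D v m) Y = X ∧ ProbSat Y φ := by
  induction m with
  | zero =>
    intro D v hD X hX φ
    constructor
    · intro h
      exact ⟨X, hX, proj_self X _, h⟩
    · rintro ⟨Y, -, h, hs⟩
      rw [← h]
      exact (proj_self Y (subset_block D v 0)).symm ▸ hs
  | succ m ih =>
    intro D v hD X hX φ
    have hv : v ∉ D := fun h => lt_irrefl _ (hD v h)
    simp only [exBlock, ProbSat, mem_supplement_of_notMem hv]
    constructor
    · rintro ⟨Y, ⟨hY, hYX⟩, h⟩
      obtain ⟨Z, hZ, hZY, h⟩ := (ih (lt_succ_of_mem_insert hD) hY φ).1 h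
      refine ⟨Z, hZ, ?_, h⟩
      rw [← hYX, ← hZY, proj_proj]
      rfl
    · rintro ⟨Z, hZ, hZX, h⟩
      refine ⟨proj (subset_block _ _ _) Z, ⟨hZ.proj _, ?_⟩, ?_⟩
      · rw [← hZX]
        exact proj_proj (D.subset_insert v) (subset_block (insert v D) (v + 1) m) Z
      · exact (ih (lt_succ_of_mem_insert hD) (hZ.proj _) φ).2 ⟨Z, hZ, rfl, h⟩

theorem probSat_allBlock [Nonempty A] {m : ℕ} : ∀ {D : Finset ℕ} {v : ℕ} (_ : ∀ w ∈ D, w < v)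
    {X : Weight D A} (_ : IsProbTeam X) (φ : Formula L C (block D v m)),
    ∃ W : Weight (block D v m) A, IsProbTeam W ∧ proj (subset_block D v m) W = X ∧
      (∀ t, W t = X (Finset.restrict₂ (π := fun _ => A) (subset_block D v m) t) /
        (Fintype.card A : ℝ) ^ m) ∧
      (ProbSat X (allBlock v m φ) ↔ ProbSat W φ) := by
  induction m with
  | zero =>
    intro D v hD X hX φ
    exact ⟨X, hX, proj_self X _, fun t => by rw [pow_zero, div_one]; rfl, Iff.rfl⟩
  | succ m ih =>
    intro D v hD X hX φ
    have hv : v ∉ D := fun h => lt_irrefl _ (hD v h)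
    have hdup := (mem_supplement_of_notMem hv).1 (duplicate_mem_supplement hX v)
    obtain ⟨W, hW, hWX, hWt, h⟩ := ih (lt_succ_of_mem_insert hD) hdup.1 φ
    refine ⟨W, hW, ?_, fun t => ?_, h⟩
    · rw [← hdup.2, ← hWX, proj_proj]
      rfl
    · refine (hWt t).trans ?_
      rw [duplicate_of_notMem hv, div_div, pow_succ']
      rfl

open Classical in
/-- Fresh variables can be given the distribution of `y` while they copy `x` on an event `E`,
provided that `x` restricted to `E` has at most the weights of `y`. -/
theorem exists_extension {v n : ℕ} (hD : ∀ w ∈ D, w < v) {W : Weight D A} (hW : IsProbTeam W)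
    (E : Set (Assignment D A)) (x y : Fin n → D)
    (hle : ∀ a, weightAt (E.indicator W) x a ≤ weightAt W y a) :
    ∃ Y : Weight (block D v n) A, IsProbTeam Y ∧ proj (subset_block D v n) Y = W ∧
      (∀ t ∈ supp Y, Finset.restrict₂ (π := fun _ => A) (subset_block D v n) t ∈ E →
        ∀ i, t (blockVar D v n i) = t (liftVar (subset_block D v n) (x i))) ∧
      ∀ a, weightAt Y (blockVar D v n) a =
        weightAt Y (fun i => liftVar (subset_block D v n) (y i)) a := by
  -- The weight of y that the copies of x on E leave over; its total is the weight δ of the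
  -- complement of E.
  let r : (Fin n → A) → ℝ := fun b => weightAt W y b - weightAt (E.indicator W) x b
  have hr : ∀ b, 0 ≤ r b := fun b => sub_nonneg.2 (hle b)
  let δ : ℝ := ∑ s, Eᶜ.indicator W s
  have hδ0 : ∀ s, 0 ≤ Eᶜ.indicator W s := fun s => Set.indicator_nonneg (fun s _ => hW.1 s) s
  have hrδ : ∑ b, r b = δ := by
    simp only [r, δ]
    rw [Finset.sum_sub_distrib, weightAt_eq_push, weightAt_eq_push, sum_push, sum_push,
      ← Finset.sum_sub_distrib]
    refine Finset.sum_congr rfl fun s _ => ?_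
    by_cases h : s ∈ E <;> simp [h]
  -- If δ = 0, then r vanishes as well, so division by zero does no harm.
  have hdiv : ∀ b, δ * (r b / δ) = r b := fun b => by
    by_cases h : δ = 0
    · have := (Finset.sum_eq_zero_iff_of_nonneg fun b _ => hr b).1 (hrδ.trans h) b
        (Finset.mem_univ b)
      rw [h, this, zero_mul]
    · exact mul_div_cancel₀ _ h
  -- On E the new tuple is x; off E it is drawn from r / δ independently of the assignment. Its
  -- marginal is the weight of x on E plus r, which is that of y.
  let w : Assignment D A × (Fin n → A) → ℝ := fun p =>
    (if p.2 = fun i => p.1 (x i) then E.indicator W p.1 else 0) +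
      Eᶜ.indicator W p.1 * (r p.2 / δ)
  have hEW : ∀ s, 0 ≤ E.indicator W s := fun s => Set.indicator_nonneg (fun s _ => hW.1 s) s
  have hw : ∀ p, 0 ≤ w p := fun p => by
    refine add_nonneg ?_ (mul_nonneg (hδ0 _)
      (div_nonneg (hr _) (Finset.sum_nonneg fun s _ => hδ0 s)))
    split_ifs
    · exact hEW _
    · exact le_rfl
  have hsum : ∀ s, ∑ b, w (s, b) = W s := fun s => by
    simp only [w]
    rw [Finset.sum_add_distrib, ← Finset.mul_sum, ← Finset.sum_div, hrδ]
    simp only [Finset.sum_ite_eq', Finset.mem_univ, if_true]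
    have : Eᶜ.indicator W s * (δ / δ) = Eᶜ.indicator W s := by
      by_cases h : δ = 0
      · have := (Finset.sum_eq_zero_iff_of_nonneg fun s _ => hδ0 s).1 h s (Finset.mem_univ s)
        rw [this, zero_mul]
      · rw [div_self h, mul_one]
    rw [this, Set.indicator_self_add_compl_apply]
  let e : Assignment D A × (Fin n → A) → Assignment (block D v n) A := fun p => extend p.1 p.2
  have hproj : proj (subset_block D v n) (push e w) = W := by
    rw [proj_eq_push, push_push]
    have : Finset.restrict₂ (π := fun _ => A) (subset_block D v n) ∘ e = fun p => id p.1 := by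
      ext1 p
      exact restrict_extend p.1 p.2
    rw [this, push_fst]
    simp only [hsum]
    ext s
    exact push_injective_apply Function.injective_id W s
  refine ⟨push e w, isProbTeam_push _ hw ?_, hproj, fun t ht htE i => ?_, fun a => ?_⟩
  · rw [Fintype.sum_prod_type]
    simp only [hsum]
    refine hW.2.imp_right fun h => ?_
    ext ⟨s, b⟩
    have := hsum s
    rw [h, Pi.zero_apply, Finset.sum_eq_zero_iff_of_nonneg fun _ _ => hw _] at this
    exact this b (Finset.mem_univ b)
  · obtain ⟨⟨s, b⟩, rfl, h⟩ := (push_pos_iff e hw t).1 ht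
    simp only [e] at htE ⊢
    rw [restrict_extend] at htE
    rw [extend_blockVar hD, extend_liftVar]
    simp only [w] at h
    split_ifs at h with hb
    · rw [hb]
    · simp [htE] at h
  · have h1 : weightAt (push e w) (fun i => liftVar (subset_block D v n) (y i)) =
        weightAt W y := by
      conv_rhs => rw [← hproj]
      rw [weightAt_proj]
      rfl
    have h2 : ((fun (s : Assignment (block D v n) A) i => s (blockVar D v n i)) ∘ e) =
        Prod.snd := by
      ext p i
      exact extend_blockVar hD p.1 p.2 i
    rw [h1, weightAt_eq_push, push_push, h2, push_apply, Fintype.sum_prod_type]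
    simp only [Finset.sum_ite_eq', Finset.mem_univ, if_true, w]
    rw [Finset.sum_add_distrib, ← Finset.sum_mul, hdiv]
    simp only [r]
    rw [weightAt_eq_push (X := E.indicator W), push_apply]
    simp only [eq_comm]
    ring

/-! ### Flat formulas -/

/-- `φ` is satisfied by the probabilistic teams whose support consists of assignments with `P`. -/
def IsFlat (φ : Formula L C D) (P : Assignment D A → Prop) : Prop :=
  ∀ X : Weight D A, IsProbTeam X → (ProbSat X φ ↔ ∀ s ∈ supp X, P s)

theorem IsFlat.and {φ ψ : Formula L C D} {P Q : Assignment D A → Prop} (hφ : IsFlat φ P)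
    (hψ : IsFlat ψ Q) : IsFlat (.and φ ψ) fun s => P s ∧ Q s := fun X hX => by
  rw [ProbSat, hφ X hX, hψ X hX]
  exact ⟨fun h s hs => ⟨h.1 s hs, h.2 s hs⟩, fun h => ⟨fun s hs => (h s hs).1,
    fun s hs => (h s hs).2⟩⟩

/-- The support is split into the possibly overlapping parts where P and Q hold; the weights play no
role, whence the trivial bound c = 0 in `exists_split`. -/
theorem IsFlat.or {φ ψ : Formula L C D} {P Q : Assignment D A → Prop} (hφ : IsFlat φ P)
    (hψ : IsFlat ψ Q) : IsFlat (.or φ ψ) fun s => P s ∨ Q s := fun X hX => by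
  rw [ProbSat]
  constructor
  · rintro ⟨Y, Z, hY, hZ, ⟨α, hα, h⟩, hYs, hZs⟩ s hs
    exact ((mem_supp_of_mix hY hZ hα h s).1 hs).imp (fun h => (hφ Y hY).1 hYs s h.2)
      fun h => (hψ Z hZ).1 hZs s h.2
  · intro h
    obtain ⟨Y, Z, hY, hZ, hα, hYs, hZs, -⟩ := exists_split hX
      (S := {s ∈ supp X | P s}) (T := {s ∈ supp X | Q s}) (c := 0) (fun s _ => hX.1 s) (by
        ext s
        exact ⟨fun h => h.elim And.left And.left, fun hs => (h s hs).imp (⟨hs, ·⟩) (⟨hs, ·⟩)⟩)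
    exact ⟨Y, Z, hY, hZ, hα, (hφ Y hY).2 fun s hs => (hYs ▸ hs).2,
      (hψ Z hZ).2 fun s hs => (hZs ▸ hs).2⟩

theorem isFlat_eq (x y : D) : IsFlat (L := L) (C := C) (A := A) (.eq x y) fun s => s x = s y :=
  fun _ _ => by rw [ProbSat]

theorem isFlat_neq (x y : D) : IsFlat (L := L) (C := C) (A := A) (.neq x y) fun s => s x ≠ s y :=
  fun _ _ => by rw [ProbSat]

/-- The disjunction of `φ` and the inequalities of the pairs in a list. -/
def neqOr (l : List (D × D)) (φ : Formula L C D) : Formula L C D :=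
  l.foldr (fun p ψ => .or (.neq p.1 p.2) ψ) φ

/-- The conjunction of `φ` and the equations of the pairs in a list. -/
def eqAnd (l : List (D × D)) (φ : Formula L C D) : Formula L C D :=
  l.foldr (fun p ψ => .and (.eq p.1 p.2) ψ) φ

theorem IsFlat.neqOr (l : List (D × D)) {φ : Formula L C D} {P : Assignment D A → Prop}
    (hφ : IsFlat φ P) : IsFlat (neqOr l φ) fun s => (∀ p ∈ l, s p.1 = s p.2) → P s := by
  induction l with
  | nil => simpa [TeamLogic.neqOr] using hφ
  | cons p l ih =>
    have := (isFlat_neq p.1 p.2).or ih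
    simp only [List.forall_mem_cons, and_imp, imp_iff_not_or (a := (_ : A) = _)]
    exact this

theorem IsFlat.eqAnd (l : List (D × D)) {φ : Formula L C D} {P : Assignment D A → Prop}
    (hφ : IsFlat φ P) : IsFlat (eqAnd l φ) fun s => (∀ p ∈ l, s p.1 = s p.2) ∧ P s := by
  induction l with
  | nil => simpa [TeamLogic.eqAnd] using hφ
  | cons p l ih =>
    have := (isFlat_eq p.1 p.2).and ih
    simp only [List.forall_mem_cons, and_assoc]
    exact this

end TeamLogic

namespace TeamLogic

open FirstOrder Finset

variable {L : Language} {A : Type*} {D : Finset ℕ}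

/-! ### Inclusion atoms with bounded weights -/

/-- A bound on the variables in `D`. -/
def freshVar (D : Finset ℕ) : ℕ := D.sup id + 1

theorem lt_freshVar : ∀ w ∈ D, w < freshVar D :=
  fun _ hw => Nat.lt_succ_of_le (Finset.le_sup (f := id) hw)

/-- The domain `D` extended by `k + 1` fresh variables. -/
abbrev eventDomain (D : Finset ℕ) (k : ℕ) : Finset ℕ := block D (freshVar D) (k + 1)

/-- The domain `D` extended by `k + 1` and another `n` fresh variables. -/
abbrev copyDomain (D : Finset ℕ) (k n : ℕ) : Finset ℕ :=
  block (eventDomain D k) (freshVar D + (k + 1)) n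

theorem eventDomain_subset (D : Finset ℕ) (k n : ℕ) : eventDomain D k ⊆ copyDomain D k n :=
  subset_block _ _ _

/-- The pairs of fresh variables that agree in the event of probability `1 / |A| ^ k`. -/
def eventPairs (D : Finset ℕ) (k : ℕ) : List (eventDomain D k × eventDomain D k) :=
  List.ofFn fun i : Fin k => (blockVar D (freshVar D) (k + 1) i.succ,
    blockVar D (freshVar D) (k + 1) 0)

/-- The formula which says that there is a tuple with the distribution of `y` that agrees with `x`
in an event of probability `1 / |A| ^ k` independent of `x`. -/
def boundedInclusion (k : ℕ) {n : ℕ} (x y : Fin n → D) :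
    Formula L {DepKind.marginalIdentity} D :=
  let z : copyDomain D k n :=
    liftVar (eventDomain_subset D k n) (blockVar D (freshVar D) (k + 1) 0)
  let u := blockVar (eventDomain D k) (freshVar D + (k + 1)) n
  let lift : D → copyDomain D k n := fun v =>
    liftVar (eventDomain_subset D k n) (liftVar (subset_block D _ _) v)
  allBlock (freshVar D) (k + 1) <| exBlock (freshVar D + (k + 1)) n <| .and
    (neqOr ((eventPairs D k).map fun p =>
        (liftVar (eventDomain_subset D k n) p.1, liftVar (eventDomain_subset D k n) p.2))
      (eqAnd (List.ofFn fun i => (u i, lift (x i))) (.eq z z)))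
    (.dep .marginalIdentity rfl u fun i => lift (y i))

/-- Covers a disjunct that enters a probabilistic mixture with coefficient 0. -/
theorem teamSat_empty [L.Structure A] (φ : Formula L {DepKind.inclusion} D) :
    TeamSat (∅ : Set (Assignment D A)) φ := by
  induction φ with
  | eq x y | neq x y | rel R x | nrel R x => exact fun s hs => hs.elim
  | dep d hd x y => exact fun s hs => hs.elim
  | and φ ψ ihφ ihψ => exact ⟨ihφ, ihψ⟩
  | or φ ψ ihφ ihψ => exact ⟨∅, ∅, Set.union_empty ∅, ihφ, ihψ⟩
  | ex x φ ih =>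
    refine ⟨fun _ => ∅, fun s hs => hs.elim, ?_⟩
    simpa using ih
  | all x φ ih =>
    rw [TeamSat]
    simpa using ih

variable [Fintype A]

theorem weightAt_pos_iff {X : Weight D A} (hX : IsProbTeam X) {n : ℕ} (x : Fin n → D)
    (a : Fin n → A) : 0 < weightAt X x a ↔ ∃ s ∈ supp X, (fun i => s (x i)) = a := by
  rw [weightAt_eq_push, push_pos_iff _ hX.1]
  exact exists_congr fun _ => and_comm

theorem weightAt_le_sum {X : Weight D A} (hX : ∀ s, 0 ≤ X s) {n : ℕ} (x : Fin n → D)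
    (a : Fin n → A) : weightAt X x a ≤ ∑ s, X s := by
  classical
  exact Finset.sum_le_sum_of_subset_of_nonneg (Finset.filter_subset _ _) fun s _ _ => hX s

/-- On the event, an assignment is determined by its restriction to D and the common value of the
fresh variables. So at most |A| extensions of each s count, each of weight X s / |A| ^ (k + 1). -/
theorem sum_event_le [Nonempty A] {X : Weight D A} (hX : IsProbTeam X) (k : ℕ)
    {W : Weight (eventDomain D k) A}
    (hW : ∀ t, W t = X (Finset.restrict₂ (π := fun _ => A) (subset_block D _ _) t) /
      (Fintype.card A : ℝ) ^ (k + 1)) :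
    ∑ t, {t | ∀ p ∈ eventPairs D k, t p.1 = t p.2}.indicator W t ≤
      1 / (Fintype.card A : ℝ) ^ k := by
  classical
  let z := blockVar D (freshVar D) (k + 1) 0
  let f : Assignment (eventDomain D k) A → Assignment D A × A := fun t =>
    (Finset.restrict₂ (π := fun _ => A) (subset_block D _ _) t, t z)
  have hinj : Set.InjOn f {t | ∀ p ∈ eventPairs D k, t p.1 = t p.2} := by
    intro t ht t' ht' h
    have key : ∀ t ∈ {t : Assignment (eventDomain D k) A | ∀ p ∈ eventPairs D k, t p.1 = t p.2},
        ∀ i, t (blockVar D (freshVar D) (k + 1) i) = t z := by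
      intro t ht i
      refine Fin.cases rfl (fun i => ?_) i
      exact ht (_, _) (List.mem_ofFn.2 ⟨i, rfl⟩)
    obtain ⟨h1, h2⟩ := Prod.ext_iff.1 h
    ext ⟨w, hw⟩
    rcases mem_block.1 hw with hD | hD
    · exact congrFun h1 ⟨w, hD⟩
    · obtain ⟨i, rfl⟩ := Nat.exists_eq_add_of_le hD.1
      have hi : i < k + 1 := by omega
      exact (key t ht ⟨i, hi⟩).trans (h2.trans (key t' ht' ⟨i, hi⟩).symm)
  have hn : (Fintype.card A : ℝ) ≠ 0 := by simp
  calc ∑ t, {t | ∀ p ∈ eventPairs D k, t p.1 = t p.2}.indicator W t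
      = ∑ t with t ∈ {t | ∀ p ∈ eventPairs D k, t p.1 = t p.2},
          X (f t).1 / (Fintype.card A : ℝ) ^ (k + 1) := by
        rw [Finset.sum_filter]
        refine Finset.sum_congr rfl fun t _ => ?_
        rw [Set.indicator_apply, hW]
    _ = ∑ q ∈ Finset.image f {t | t ∈ {t | ∀ p ∈ eventPairs D k, t p.1 = t p.2}},
          X q.1 / (Fintype.card A : ℝ) ^ (k + 1) := by
        rw [Finset.sum_image]
        simpa using hinj
    _ ≤ ∑ q : Assignment D A × A, X q.1 / (Fintype.card A : ℝ) ^ (k + 1) :=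
        Finset.sum_le_sum_of_subset_of_nonneg (Finset.subset_univ _)
          fun q _ _ => div_nonneg (hX.1 _) (by positivity)
    _ = (∑ s, X s) / (Fintype.card A : ℝ) ^ k := by
        rw [Fintype.sum_prod_type, Finset.sum_div]
        refine Finset.sum_congr rfl fun s _ => ?_
        simp only [Finset.sum_const, Finset.card_univ, nsmul_eq_mul, pow_succ]
        field_simp
    _ ≤ 1 / (Fintype.card A : ℝ) ^ k := by
        gcongr
        exact hX.sum_le_one

variable [L.Structure A]

/-- The flat conjunct of `boundedInclusion` is an implication in disguise: either two paired
variables differ, or u copies x. The trivial equation of the first fresh variable with itself stands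
for truth. -/
theorem isFlat_boundedInclusion (k : ℕ) {n : ℕ} (x : Fin n → D) :
    IsFlat (L := L) (C := {DepKind.marginalIdentity}) (A := A)
      (neqOr ((eventPairs D k).map fun p =>
          (liftVar (eventDomain_subset D k n) p.1, liftVar (eventDomain_subset D k n) p.2))
        (eqAnd (List.ofFn fun i => (blockVar (eventDomain D k) (freshVar D + (k + 1)) n i,
            liftVar (eventDomain_subset D k n) (liftVar (subset_block D _ _) (x i))))
          (.eq (liftVar (eventDomain_subset D k n) (blockVar D (freshVar D) (k + 1) 0))
            (liftVar (eventDomain_subset D k n) (blockVar D (freshVar D) (k + 1) 0)))))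
      fun t => Finset.restrict₂ (π := fun _ => A) (eventDomain_subset D k n) t ∈
          {t | ∀ p ∈ eventPairs D k, t p.1 = t p.2} →
        ∀ i, t (blockVar (eventDomain D k) (freshVar D + (k + 1)) n i) =
          t (liftVar (eventDomain_subset D k n) (liftVar (subset_block D _ _) (x i))) := by
  have h := IsFlat.neqOr (L := L) (C := {DepKind.marginalIdentity}) (A := A)
    ((eventPairs D k).map fun p =>
      (liftVar (eventDomain_subset D k n) p.1, liftVar (eventDomain_subset D k n) p.2))
    ((isFlat_eq (liftVar (eventDomain_subset D k n) (blockVar D (freshVar D) (k + 1) 0))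
      (liftVar (eventDomain_subset D k n) (blockVar D (freshVar D) (k + 1) 0))).eqAnd
      (List.ofFn fun i => (blockVar (eventDomain D k) (freshVar D + (k + 1)) n i,
        liftVar (eventDomain_subset D k n) (liftVar (subset_block D _ _) (x i)))))
  convert h using 2 with t
  simp only [List.forall_mem_map, List.forall_mem_ofFn_iff, and_true]
  rfl

theorem inclusionHolds_of_boundedInclusion [Nonempty A] {X : Weight D A} (hX : IsProbTeam X)
    {k n : ℕ} {x y : Fin n → D} (h : ProbSat (L := L) X (boundedInclusion k x y)) :
    InclusionHolds (supp X) x y := by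
  obtain ⟨W, hW, hWX, hWt, h'⟩ :=
    probSat_allBlock (L := L) (C := {DepKind.marginalIdentity}) lt_freshVar hX _
  obtain ⟨Y, hY, hYW, hflat, hdep⟩ :=
    (probSat_exBlock (lt_of_mem_block lt_freshVar) hW _).1 (h'.1 h)
  rw [isFlat_boundedInclusion (L := L) k x Y hY] at hflat
  intro s hs
  obtain ⟨a⟩ := ‹Nonempty A›
  -- Giving all universally quantified variables the same value places an extension of s in the
  -- event.
  have hpos : extend s (fun _ => a) ∈ supp W := by
    rw [supp, Set.mem_ofPred_eq, hWt, restrict_extend]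
    exact div_pos hs (by simp [Fintype.card_pos_iff.2 ⟨a⟩])
  rw [← hYW, mem_supp_proj _ hY] at hpos
  obtain ⟨t, ht, hts⟩ := hpos
  have hu := hflat t ht (by
    rw [hts]
    simp only [eventPairs, Set.mem_ofPred_eq, List.forall_mem_ofFn_iff,
      extend_blockVar lt_freshVar, implies_true])
  have hux := (weightAt_pos_iff hY (blockVar (eventDomain D k) (freshVar D + (k + 1)) n) _).2
    ⟨t, ht, rfl⟩
  rw [hdep, weightAt_pos_iff hY] at hux
  obtain ⟨t', ht', h⟩ := hux
  refine ⟨Finset.restrict₂ (π := fun _ => A) (subset_block D (freshVar D) (k + 1))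
    (Finset.restrict₂ (π := fun _ => A) (eventDomain_subset D k n) t'), ?_, ?_⟩
  · rw [← hWX, mem_supp_proj _ hW]
    refine ⟨_, ?_, rfl⟩
    rw [← hYW, mem_supp_proj _ hY]
    exact ⟨t', ht', rfl⟩
  · refine Eq.trans ?_ h.symm
    ext i
    rw [hu i]
    have := congrFun hts (liftVar (subset_block D _ _) (x i))
    rw [extend_liftVar] at this
    exact this.symm

theorem boundedInclusion_of_inclusionHolds [Nonempty A] {X : Weight D A} (hX : IsProbTeam X)
    {k n : ℕ} {x y : Fin n → D} (hk : ∀ s ∈ supp X, 1 / (Fintype.card A : ℝ) ^ k ≤ X s)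
    (h : InclusionHolds (supp X) x y) : ProbSat (L := L) X (boundedInclusion k x y) := by
  obtain ⟨W, hW, hWX, hWt, h'⟩ :=
    probSat_allBlock (L := L) (C := {DepKind.marginalIdentity}) lt_freshVar hX _
  refine h'.2 ((probSat_exBlock (lt_of_mem_block lt_freshVar) hW _).2 ?_)
  have hle : ∀ a, weightAt ({t | ∀ p ∈ eventPairs D k, t p.1 = t p.2}.indicator W)
      (fun i => liftVar (subset_block D _ _) (x i)) a ≤
        weightAt W (fun i => liftVar (subset_block D _ _) (y i)) a := by
    intro a
    have hind : ∀ t, 0 ≤ {t | ∀ p ∈ eventPairs D k, t p.1 = t p.2}.indicator W t :=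
      fun t => Set.indicator_nonneg (fun t _ => hW.1 t) t
    have hWy : weightAt W (fun i => liftVar (subset_block D _ _) (y i)) a = weightAt X y a := by
      conv_rhs => rw [← hWX, weightAt_proj]
      rfl
    rw [hWy]
    by_cases hxa : ∃ s ∈ supp X, (fun i => s (x i)) = a
    · obtain ⟨s, hs, rfl⟩ := hxa
      obtain ⟨s', hs', hss'⟩ := h s hs
      rw [hss']
      -- The event as a whole weighs no more than the single assignment s' that witnesses the
      -- inclusion.
      calc _ ≤ ∑ t, {t | ∀ p ∈ eventPairs D k, t p.1 = t p.2}.indicator W t :=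
            weightAt_le_sum hind _ _
        _ ≤ 1 / (Fintype.card A : ℝ) ^ k := sum_event_le hX k hWt
        _ ≤ X s' := hk s' hs'
        _ ≤ weightAt X y fun i => s' (y i) := by
            rw [weightAt_eq_push]
            exact le_push (fun (s : Assignment D A) i => s (y i)) hX.1 s'
    -- A value that x never takes has weight 0 under x, and restricting to the event cannot increase
    -- it.
    · have h0 : ¬ 0 < weightAt W (fun i => liftVar (subset_block D _ _) (x i)) a := by
        rw [← weightAt_pos_iff hX, ← hWX, weightAt_proj] at hxa
        exact hxa
      refine le_trans (le_trans ?_ (not_lt.1 h0)) (Finset.sum_nonneg fun s _ => hX.1 s)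
      exact Finset.sum_le_sum fun t _ => Set.indicator_le_self' (fun t _ => hW.1 t) t
  obtain ⟨Y, hY, hYW, hE, hY'⟩ := exists_extension (n := n)
    (lt_of_mem_block (m := k + 1) (lt_freshVar (D := D))) hW
    {t | ∀ p ∈ eventPairs D k, t p.1 = t p.2}
    (fun i => liftVar (subset_block D _ _) (x i)) (fun i => liftVar (subset_block D _ _) (y i)) hle
  exact ⟨Y, hY, hYW, (isFlat_boundedInclusion (L := L) k x Y hY).2 hE, hY'⟩

/-! ### The translation -/

/-- The translation of inclusion logic which is correct for teams with weights at least
`1 / |A| ^ k`. -/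
def translate : {D : Finset ℕ} → ℕ → Formula L {DepKind.inclusion} D →
    Formula L {DepKind.marginalIdentity} D
  | _, _, .eq x y => .eq x y
  | _, _, .neq x y => .neq x y
  | _, _, .rel R x => .rel R x
  | _, _, .nrel R x => .nrel R x
  | _, k, .dep _ _ x y => boundedInclusion k x y
  | _, k, .and φ ψ => .and (translate k φ) (translate k ψ)
  | _, k, .or φ ψ => .or (translate (k + 1) φ) (translate (k + 1) ψ)
  | _, k, .ex x φ => .ex x (translate (k + 1) φ)
  | _, k, .all x φ => .all x (translate (k + 1) φ)

theorem probSat_of_translate [Nonempty A] (φ : Formula L {DepKind.inclusion} D) :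
    ∀ {X : Weight D A} (_ : IsProbTeam X) {k : ℕ}, ProbSat X (translate k φ) → ProbSat X φ := by
  induction φ with
  | eq x y | neq x y | rel R x | nrel R x => exact fun _ _ h => h
  | dep d hd x y =>
    intro X hX k h
    obtain rfl : d = .inclusion := hd
    exact inclusionHolds_of_boundedInclusion hX h
  | and φ ψ ihφ ihψ => exact fun hX _ h => ⟨ihφ hX h.1, ihψ hX h.2⟩
  | or φ ψ ihφ ihψ =>
    rintro X hX k ⟨Y, Z, hY, hZ, h, hYs, hZs⟩
    exact ⟨Y, Z, hY, hZ, h, ihφ hY hYs, ihψ hZ hZs⟩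
  | ex x φ ih =>
    rintro X hX k ⟨Y, hY, h⟩
    exact ⟨Y, hY, ih hY.1 h⟩
  | all x φ ih => exact fun hX _ h => ih (duplicate_mem_supplement hX x).1 h

theorem teamSat_of_probSat [Nonempty A] (φ : Formula L {DepKind.inclusion} D) :
    ∀ {X : Weight D A} (_ : IsProbTeam X), ProbSat X φ → TeamSat (supp X) φ := by
  induction φ with
  | eq x y | neq x y | rel R x | nrel R x => exact fun _ h => h
  | dep d hd x y =>
    intro X hX h
    obtain rfl : d = .inclusion := hd
    exact h
  | and φ ψ ihφ ihψ => exact fun hX h => ⟨ihφ hX h.1, ihψ hX h.2⟩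
  | or φ ψ ihφ ihψ =>
    rintro X hX ⟨Y, Z, hY, hZ, ⟨α, hα, h⟩, hYs, hZs⟩
    have hmem := mem_supp_of_mix hY hZ hα h
    -- A component with coefficient 0 adds nothing to the support of X, so it is replaced by the
    -- empty team.
    refine ⟨{s | 0 < α ∧ s ∈ supp Y}, {s | α < 1 ∧ s ∈ supp Z}, ?_, ?_, ?_⟩
    · ext s
      exact (hmem s).symm
    · by_cases h0 : 0 < α
      · simpa [h0] using ihφ hY hYs
      · simpa [h0] using teamSat_empty φ
    · by_cases h0 : α < 1
      · simpa [h0] using ihψ hZ hZs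
      · simpa [h0] using teamSat_empty ψ
  | ex x φ ih =>
    rintro X hX ⟨Y, hY, h⟩
    obtain ⟨h1, h2⟩ := supp_of_mem_supplement hX hY
    refine ⟨_, h1, ?_⟩
    rw [h2]
    exact ih hY.1 h
  | all x φ ih =>
    intro X hX h
    rw [TeamSat, ← supp_duplicate hX]
    exact ih (duplicate_mem_supplement hX x).1 h

theorem translate_of_teamSat [Nontrivial A] (φ : Formula L {DepKind.inclusion} D) :
    ∀ {X : Weight D A} (_ : IsProbTeam X) {k : ℕ}
      (_ : ∀ s ∈ supp X, 1 / (Fintype.card A : ℝ) ^ k ≤ X s),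
      TeamSat (supp X) φ → ProbSat X (translate k φ) := by
  have hpow : ∀ k, 1 / (Fintype.card A : ℝ) ^ (k + 1) = 1 / (Fintype.card A : ℝ) ^ k /
      Fintype.card A := fun k => by rw [pow_succ, div_div]
  induction φ with
  | eq x y | neq x y | rel R x | nrel R x => exact fun _ _ _ h => h
  | dep d hd x y => exact fun hX _ hk h => boundedInclusion_of_inclusionHolds hX hk h
  | and φ ψ ihφ ihψ => exact fun hX _ hk h => ⟨ihφ hX hk h.1, ihψ hX hk h.2⟩
  | or φ ψ ihφ ihψ =>
    rintro X hX k hk ⟨S, T, hST, hS, hT⟩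
    obtain ⟨Y, Z, hY, hZ, h, rfl, rfl, hYc, hZc⟩ := exists_split hX hk hST
    -- Halving is paid for by one factor |A|; this is where two elements are needed.
    have h2 : 1 / (Fintype.card A : ℝ) ^ (k + 1) ≤ 1 / (Fintype.card A : ℝ) ^ k / 2 := by
      rw [hpow]
      have : (2 : ℝ) ≤ Fintype.card A := by exact_mod_cast Fintype.one_lt_card (α := A)
      gcongr
    exact ⟨Y, Z, hY, hZ, h, ihφ hY (fun s hs => h2.trans (hYc s hs)) hS,
      ihψ hZ (fun s hs => h2.trans (hZc s hs)) hT⟩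
  | ex x φ ih =>
    rintro X hX k hk ⟨F, hF, h⟩
    obtain ⟨Y, hY, hYs, hYc⟩ := exists_mem_supplement hX hk x hF
    rw [← hYs] at h
    exact ⟨Y, hY, ih hY.1 (by rwa [hpow]) h⟩
  | all x φ ih =>
    intro X hX k hk h
    rw [TeamSat, ← supp_duplicate hX] at h
    exact ih (duplicate_mem_supplement hX x).1 (by rw [hpow]; exact le_duplicate hX hk x) h

end TeamLogic

theorem mainTheorem6 {L : FirstOrder.Language} [L.IsRelational]
    (φ : TeamLogic.InclusionSentence L) :
    ∃ ψ : TeamLogic.ProbInclusionSentence L,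
      ∀ (A : Type*) [Fintype A] [Nontrivial A] [L.Structure A],
        (TeamLogic.TeamModels A φ ↔ TeamLogic.ProbModels A ψ) ∧
        (TeamLogic.ProbModels A φ ↔ TeamLogic.ProbModels A ψ) := by
  -- The initial team has weight 1 = 1 / |A| ^ 0, so the count starts at 0.
  refine ⟨TeamLogic.translate 0 φ, fun A _ _ _ => ?_⟩
  have hX : TeamLogic.IsProbTeam (D := ∅) (A := A) fun _ => 1 :=
    ⟨fun _ => zero_le_one, .inl (by simp)⟩
  have hsupp : TeamLogic.supp (D := ∅) (A := A) (fun _ => 1) = Set.univ :=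
    Set.eq_univ_of_forall fun _ => zero_lt_one (α := ℝ)
  have h1 : TeamLogic.ProbModels A (TeamLogic.translate 0 φ) → TeamLogic.ProbModels A φ :=
    TeamLogic.probSat_of_translate φ hX
  have h2 : TeamLogic.ProbModels A φ → TeamLogic.TeamModels A φ := fun h => by
    rw [TeamLogic.TeamModels, ← hsupp]
    exact TeamLogic.teamSat_of_probSat φ hX h
  have h3 : TeamLogic.TeamModels A φ → TeamLogic.ProbModels A (TeamLogic.translate 0 φ) :=
    fun h => by
      rw [TeamLogic.TeamModels, ← hsupp] at h
      exact TeamLogic.translate_of_teamSat φ hX (fun _ _ => by simp) h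
  exact ⟨⟨h3, h2 ∘ h1⟩, ⟨h3 ∘ h2, h1⟩⟩
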